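/- Let $\mathbb T=\{z\in\mathbb C:|z|=1\}$. A $\mathbb T$-gain graph $\Phi=(G,\varphi)$ is a finite simple graph $G$ together with a map $\varphi$ from the set of oriented edges of $G$ to $\mathbb T$ such that $\varphi(\overrightarrow{e_{s,t}})=\varphi(\overrightarrow{e_{t,s}})^{-1}$ for every edge $v_sv_t$ of $G$. Its adjacency matrix $A(\Phi)$ is the Hermitian matrix whose $(s,t)$ entry is $\varphi(\overrightarrow{e_{s,t}})$ if $v_s$ and $v_t$ are adjacent and $0$ otherwise, and its rank $r(\Phi)$ is the rank of $A(\Phi)$. The gain of an oriented cycle is the product of the gains of its oriented edges, and $\Phi$ is balanced if every cycle in it has gain $1$. Let $\Phi=(G,\varphi)$ be a $\mathbb T$-gain graph on $n$ vertices such that $G$ is connected and has maximum vertex degree $\Delta\ge 2$. Then $$r(\Phi)\ \ge\ \frac{n-2}{\Delta-1}.$$ Equality holds if and only if one of the following holds: (i) $n$ is even, $G\cong K_{n/2,n/2}$ and $\Phi$ is balanced; (ii) $n$ is even, $G$ is the cycle $C_n$, and the gain of this cycle is $\varphi(C_n)=(-1)^{n/2}$ (that is, $1$ if $4\mid n$ and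 $-1$ if $n\equiv 2 \pmod 4$). -/

import Mathlib

/-- A complex unit gain graph on the vertex set `V`: a simple graph together with a map from its
oriented edges to the unit circle, such that reversing an oriented edge inverts its gain. -/
structure TGainGraph (V : Type*) where
  /-- the underlying simple graph -/
  graph : SimpleGraph V
  /-- the gain of an oriented edge -/
  gain : graph.Dart → Circle
  gain_symm : ∀ d : graph.Dart, gain d.symm = (gain d)⁻¹

namespace TGainGraph

variable {V : Type*} (Φ : TGainGraph V)

open Classical in
/-- The adjacency matrix: the gain of the oriented edge from `s` to `t` if `s` and `t` are
adjacent, and `0` otherwise. -/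
noncomputable def adjMatrix : Matrix V V ℂ :=
  Matrix.of fun s t => if h : Φ.graph.Adj s t then (Φ.gain ⟨(s, t), h⟩ : ℂ) else 0

/-- The rank of a gain graph is the rank of its adjacency matrix. -/
noncomputable def rank [Fintype V] : ℕ := Φ.adjMatrix.rank

/-- The gain of a walk: the product of the gains of its oriented edges. -/
noncomputable def walkGain {u v : V} (p : Φ.graph.Walk u v) : Circle :=
  (p.darts.map Φ.gain).prod

/-- A gain graph is balanced if every cycle in it has gain `1`. -/
def Balanced : Prop :=
  ∀ (v : V) (p : Φ.graph.Walk v v), p.IsCycle → Φ.walkGain p = 1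

/-- `Φ` is a balanced gain graph on a complete bipartite graph `K_{m,m}`. -/
def IsBalancedCompleteBipartite (m : ℕ) : Prop :=
  Nonempty (completeBipartiteGraph (Fin m) (Fin m) ≃g Φ.graph) ∧ Φ.Balanced

/-- The gain `φ(v₀v₁) φ(v₁v₂) ⋯ φ(vₙ₋₁v₀)` of a gain graph whose underlying graph is identified
with the cycle on `n` vertices, `vᵢ` being the image of `i`; for `n ≥ 2` consecutive vertices are
adjacent, so that each factor is the gain of an oriented edge. -/
noncomputable def cycleGain {n : ℕ} (e : SimpleGraph.cycleGraph n ≃g Φ.graph) : ℂ :=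
  ∏ i : Fin n, Φ.adjMatrix (e i) (e (finRotate n i))

/-- `Φ` is a gain graph on the cycle with `n ≥ 3` vertices, and the gain of this cycle is `z`.
For `z = ±1`, the only values used, this does not depend on the orientation. -/
def IsCycleWithGain (n : ℕ) (z : ℂ) : Prop :=
  3 ≤ n ∧ ∃ e : SimpleGraph.cycleGraph n ≃g Φ.graph, Φ.cycleGain e = z

end TGainGraph

/-! Write Δ = d + 1, and let `rowRank W` be the dimension of the span of the rows of vertices whose
neighbourhoods lie in W. If N(v) meets W but is not contained in it, then W ∪ N(v) has at most d new
vertices, while the row of v has a nonzero entry outside W, so `rowRank` grows. Repeating this gives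
a neighbourhood-closed set. If that set is not everything, one further neighbourhood, costing d + 1
vertices, and a second closure exhaust the connected graph. Starting from a single neighbourhood,
this gives n ≤ r d + 2 (`card_le_rank_mul_add_two`).

If equality holds, every nonempty W satisfies 1 + `rowRank W` * d ≤ |W|. Hence the graph is (d +
1)-regular, and two vertices with two common neighbours have equal neighbourhoods. For d ≥ 2 a
maximality argument finds such twins, which force a complete bipartite graph; one side X then has
`rowRank X` ≤ 1, which means balance. For d = 1 the graph is a cycle of nullity two. Multiplying a
kernel vector by partial gains turns the kernel equation into y (i + 2) = -y i, which determines the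
parity of n and the gain. -/

namespace TGainGraph

variable {V : Type*} (Φ : TGainGraph V)

/-! ### Matrix entries and rows supported in a vertex set -/

theorem adjMatrix_of_adj {s t : V} (h : Φ.graph.Adj s t) :
    Φ.adjMatrix s t = Φ.gain ⟨(s, t), h⟩ := by
  simp [adjMatrix, h]

theorem adjMatrix_of_not_adj {s t : V} (h : ¬ Φ.graph.Adj s t) : Φ.adjMatrix s t = 0 := by
  simp [adjMatrix, h]

theorem adjMatrix_ne_zero_iff {s t : V} : Φ.adjMatrix s t ≠ 0 ↔ Φ.graph.Adj s t := by
  by_cases h : Φ.graph.Adj s t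
  · simp [adjMatrix_of_adj, h]
  · simp [adjMatrix_of_not_adj, h]

theorem adjMatrix_mul_swap {s t : V} (h : Φ.graph.Adj s t) :
    Φ.adjMatrix s t * Φ.adjMatrix t s = 1 := by
  have h2 := Φ.gain_symm ⟨(s, t), h⟩
  have h3 : (Φ.gain ⟨(t, s), h.symm⟩) = (Φ.gain ⟨(s, t), h⟩)⁻¹ := h2
  rw [adjMatrix_of_adj _ h, adjMatrix_of_adj _ h.symm, h3]
  simp

/-- The span of the rows of the adjacency matrix that belong to vertices all of whose neighbours
lie in `W`. -/
noncomputable def rowSpan (W : Set V) : Submodule ℂ (V → ℂ) :=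
  Submodule.span ℂ (Φ.adjMatrix.row '' {v | Φ.graph.neighborSet v ⊆ W})

theorem rowSpan_mono {W W' : Set V} (h : W ⊆ W') : Φ.rowSpan W ≤ Φ.rowSpan W' :=
  Submodule.span_mono (Set.image_mono fun _ hv => hv.trans h)

theorem row_mem_rowSpan {W : Set V} {v : V} (h : Φ.graph.neighborSet v ⊆ W) :
    Φ.adjMatrix.row v ∈ Φ.rowSpan W :=
  Submodule.subset_span ⟨v, h, rfl⟩

theorem eq_zero_of_mem_rowSpan {W : Set V} {x : V → ℂ} (hx : x ∈ Φ.rowSpan W) {t : V}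
    (ht : t ∉ W) : x t = 0 := by
  unfold rowSpan at hx
  induction hx using Submodule.span_induction with
  | mem x h =>
    obtain ⟨v, hv, rfl⟩ := h
    exact Φ.adjMatrix_of_not_adj fun h => ht (hv h)
  | zero => rfl
  | add x y _ _ h1 h2 => simp [h1, h2]
  | smul a x _ h => simp [h]

/-- The dimension of `rowSpan`. -/
noncomputable def rowRank (W : Set V) : ℕ := Module.finrank ℂ (Φ.rowSpan W)

variable [Fintype V]

theorem rowRank_le_rank (W : Set V) : Φ.rowRank W ≤ Φ.rank := by
  rw [rank, Matrix.rank_eq_finrank_span_row]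
  exact Submodule.finrank_mono (Submodule.span_mono (Set.image_subset_range _ _))

/-- The row of v is nonzero at a neighbour outside W, where every vector of `rowSpan W` vanishes. -/
theorem rowRank_lt {W W' : Set V} {v : V} (h : W ⊆ W') (hv : ¬ Φ.graph.neighborSet v ⊆ W)
    (hv' : Φ.graph.neighborSet v ⊆ W') : Φ.rowRank W < Φ.rowRank W' := by
  apply Submodule.finrank_lt_finrank_of_lt
  refine lt_of_le_of_ne (Φ.rowSpan_mono h) fun heq => hv fun t ht => ?_
  by_contra htW
  have := Φ.eq_zero_of_mem_rowSpan (heq ▸ Φ.row_mem_rowSpan hv') htW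
  exact (Φ.adjMatrix_ne_zero_iff.2 ht) this

theorem one_le_rowRank {W : Set V} {v w : V} (h : Φ.graph.Adj v w)
    (hW : Φ.graph.neighborSet v ⊆ W) : 1 ≤ Φ.rowRank W := by
  have := Φ.rowRank_lt (Set.empty_subset W) (v := v) (fun hs => hs h) hW
  omega

end TGainGraph

/-! ### Neighbourhood-closed sets and parity of walks -/

namespace SimpleGraph

variable {V : Type*} (G : SimpleGraph V)

/-- A set of vertices is neighbourhood-closed if it contains every neighbourhood it meets. -/
def NbhdClosed (W : Set V) : Prop :=
  ∀ ⦃v x : V⦄, G.Adj v x → x ∈ W → G.neighborSet v ⊆ W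

variable {G}

/-- Membership propagates two steps at a time. The second clause, for a walk entered one step after
a vertex of W, makes the induction go through. -/
theorem NbhdClosed.mem_of_walk {W : Set V} (hW : G.NbhdClosed W) {x y : V} (p : G.Walk x y) :
    (x ∈ W → Even p.length → y ∈ W) ∧ (∀ v, G.Adj v x → v ∈ W → Odd p.length → y ∈ W) := by
  induction p with
  | nil => simp
  | @cons a b c h p ih =>
    refine ⟨fun ha hp => ih.2 a h ha ?_, fun v hv hvW hp => ih.1 (hW hv.symm hvW h) ?_⟩
    · simpa [Nat.even_add_one] using hp
    · simpa [Nat.odd_add_one] using hp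

theorem NbhdClosed.mem_of_even_walk {W : Set V} (hW : G.NbhdClosed W) {x y : V} (p : G.Walk x y)
    (hx : x ∈ W) (hp : Even p.length) : y ∈ W :=
  (hW.mem_of_walk p).1 hx hp

/-- In a connected graph, a neighbourhood-closed set that properly contains a nonempty
neighbourhood-closed set is everything. -/
theorem NbhdClosed.eq_univ (hG : G.Connected) {W W' : Set V} (hW : G.NbhdClosed W)
    (hW' : G.NbhdClosed W') (hsub : W ⊆ W') {x y : V} (hx : x ∈ W) (hy : y ∈ W') (hyW : y ∉ W) :
    W' = Set.univ := by
  refine Set.eq_univ_of_forall fun z => ?_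
  obtain ⟨p⟩ := hG.preconnected x y
  obtain ⟨q⟩ := hG.preconnected x z
  have hp : ¬ Even p.length := fun h => hyW (hW.mem_of_even_walk p hx h)
  by_cases hq : Even q.length
  · exact hsub (hW.mem_of_even_walk q hx hq)
  · refine hW'.mem_of_even_walk (p.reverse.append q) hy ?_
    rw [Walk.length_append, Walk.length_reverse]
    exact (Nat.not_even_iff_odd.1 hp).add_odd (Nat.not_even_iff_odd.1 hq)

end SimpleGraph

/-! ### The growth argument and the lower bound -/

namespace TGainGraph

variable {V : Type*} (Φ : TGainGraph V) [Fintype V] [DecidableRel Φ.graph.Adj] [DecidableEq V]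

/-- The quantity |W| - d * `rowRank W` never increases when a neighbourhood overlapping W is added;
the inequality is stated additively to stay in ℕ. -/
theorem exists_nbhdClosed_superset {d : ℕ} (hd : ∀ v, Φ.graph.degree v ≤ d + 1) (W : Finset V) :
    ∃ W' : Finset V, W ⊆ W' ∧ Φ.graph.NbhdClosed W' ∧
      W'.card + Φ.rowRank W * d ≤ W.card + Φ.rowRank W' * d := by
  induction hk : Fintype.card V - W.card using Nat.strong_induction_on generalizing W with
  | _ k ih =>
    by_cases hW : Φ.graph.NbhdClosed (W : Set V)
    · exact ⟨W, subset_rfl, hW, le_rfl⟩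
    simp only [SimpleGraph.NbhdClosed, not_forall] at hW
    obtain ⟨v, x, hvx, hx, hv⟩ := hW
    set W₁ := W ∪ Φ.graph.neighborFinset v with hW₁
    have hsub : W ⊆ W₁ := Finset.subset_union_left
    have hlt : Φ.rowRank W < Φ.rowRank W₁ :=
      Φ.rowRank_lt (by exact_mod_cast hsub) hv (by intro t ht; simp [hW₁]; exact Or.inr ht)
    have hinter : 0 < (W ∩ Φ.graph.neighborFinset v).card :=
      Finset.card_pos.2 ⟨x, by simp_all⟩
    have hcard := Finset.card_union_add_card_inter W (Φ.graph.neighborFinset v)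
    rw [← hW₁, SimpleGraph.card_neighborFinset_eq_degree] at hcard
    have hdv := hd v
    have hWlt : W.card < W₁.card := by
      apply Finset.card_lt_card
      refine Finset.ssubset_iff_subset_ne.2 ⟨hsub, fun h => ?_⟩
      rw [← h] at hlt
      exact hlt.false
    have hW₁le := Finset.card_le_univ W₁
    obtain ⟨W', h1, h2, h3⟩ := ih (Fintype.card V - W₁.card) (by omega) W₁ rfl
    refine ⟨W', hsub.trans h1, h2, ?_⟩
    have := Nat.mul_le_mul_right d (Nat.succ_le_of_lt hlt)
    rw [Nat.succ_mul] at this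
    omega

/-- At most one jump to a neighbourhood outside the first closure is needed. It may add d + 1
vertices rather than d, whence the extra 1. -/
theorem card_add_rowRank_mul_le {d : ℕ} (hd : ∀ v, Φ.graph.degree v ≤ d + 1)
    (hconn : Φ.graph.Connected) (hpos : ∀ v, ∃ w, Φ.graph.Adj v w) {W : Finset V}
    (hW : W.Nonempty) :
    Fintype.card V + Φ.rowRank W * d ≤ W.card + 1 + Φ.rank * d := by
  obtain ⟨W₁, h1, hc1, hr1⟩ := Φ.exists_nbhdClosed_superset hd W
  by_cases hu : W₁ = Finset.univ
  · have hc : W₁.card = Fintype.card V := by rw [hu, Finset.card_univ]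
    have := Nat.mul_le_mul_right d (Φ.rowRank_le_rank W₁)
    omega
  obtain ⟨y, hy⟩ : ∃ y, y ∉ W₁ := by
    by_contra h
    push Not at h
    exact hu (Finset.eq_univ_iff_forall.2 h)
  obtain ⟨v, hv⟩ := hpos y
  set W₂ := W₁ ∪ Φ.graph.neighborFinset v with hW₂
  have hlt : Φ.rowRank W₁ < Φ.rowRank W₂ :=
    Φ.rowRank_lt (v := v) (by exact_mod_cast Finset.subset_union_left)
      (fun h => hy (h hv.symm)) (by intro t ht; simp [hW₂]; exact Or.inr ht)
  have hcard : W₂.card ≤ W₁.card + (d + 1) :=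
    (Finset.card_union_le _ _).trans (Nat.add_le_add_left (hd v) _)
  obtain ⟨W₃, h3, hc3, hr3⟩ := Φ.exists_nbhdClosed_superset hd W₂
  obtain ⟨x, hx⟩ := hW
  have huniv := hc1.eq_univ hconn hc3 (by exact_mod_cast Finset.subset_union_left.trans h3)
    (by exact_mod_cast h1 hx) (y := y) (by
      have : y ∈ W₂ := by simp [hW₂, hv.symm]
      exact_mod_cast h3 this) (by exact_mod_cast hy)
  have hc : W₃.card = Fintype.card V := by
    rw [Finset.coe_eq_univ.1 huniv, Finset.card_univ]
  have e1 := Nat.mul_le_mul_right d (Φ.rowRank_le_rank W₃)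
  have e2 := Nat.mul_le_mul_right d (Nat.succ_le_of_lt hlt)
  rw [Nat.succ_mul] at e2
  omega

theorem card_le_rank_mul_add_two {d : ℕ} (hd : ∀ v, Φ.graph.degree v ≤ d + 1)
    (hconn : Φ.graph.Connected) (hpos : ∀ v, ∃ w, Φ.graph.Adj v w) :
    Fintype.card V ≤ Φ.rank * d + 2 := by
  obtain ⟨v⟩ := hconn.nonempty
  obtain ⟨w, hw⟩ := hpos v
  have := Φ.card_add_rowRank_mul_le hd hconn hpos (W := Φ.graph.neighborFinset v)
    ⟨w, by simpa using hw⟩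
  have h1 := Nat.mul_le_mul_right d (Φ.one_le_rowRank hw (W := Φ.graph.neighborFinset v) (by simp))
  have h2 := hd v
  rw [SimpleGraph.card_neighborFinset_eq_degree] at this
  omega

end TGainGraph

/-! ### Combinatorial structure in the equality case -/

namespace TGainGraph

variable {V : Type*} (Φ : TGainGraph V) [Fintype V] [DecidableRel Φ.graph.Adj]

/-- Equality leaves no slack in growth from any starting set; the regularity and twin arguments use
equality only in this form. -/
theorem one_add_rowRank_mul_le {d : ℕ} (hd : ∀ v, Φ.graph.degree v ≤ d + 1)
    (hconn : Φ.graph.Connected) (hpos : ∀ v, ∃ w, Φ.graph.Adj v w)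
    (heq : Fintype.card V = Φ.rank * d + 2) (W : Finset V) (hW : W.Nonempty) :
    1 + Φ.rowRank W * d ≤ W.card := by
  classical
  have := Φ.card_add_rowRank_mul_le hd hconn hpos hW
  omega

section Extremal

variable {Φ} {d : ℕ} (hd : ∀ v, Φ.graph.degree v ≤ d + 1) (hpos : ∀ v, ∃ w, Φ.graph.Adj v w)
  (hrow : ∀ W : Finset V, W.Nonempty → 1 + Φ.rowRank W * d ≤ W.card)

include hd hpos hrow

theorem degree_eq_of_rowRank_le (v : V) : Φ.graph.degree v = d + 1 := by
  obtain ⟨w, hw⟩ := hpos v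
  have h1 := hrow (Φ.graph.neighborFinset v) ⟨w, by simpa using hw⟩
  have h2 := Nat.mul_le_mul_right d
    (Φ.one_le_rowRank hw (W := Φ.graph.neighborFinset v) (by simp))
  have h3 := hd v
  rw [SimpleGraph.card_neighborFinset_eq_degree] at h1
  omega

variable [DecidableEq V]

/-- Were the neighbourhoods distinct, their union would have `rowRank` at least 2, hence at least 2d
+ 1 vertices, so two sets of size d + 1 could share only one. -/
theorem neighborFinset_eq_of_two_le_card_inter {u v : V}
    (h : 2 ≤ (Φ.graph.neighborFinset v ∩ Φ.graph.neighborFinset u).card) :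
    Φ.graph.neighborFinset u = Φ.graph.neighborFinset v := by
  have hu := degree_eq_of_rowRank_le hd hpos hrow u
  have hv := degree_eq_of_rowRank_le hd hpos hrow v
  by_contra hne
  have hnot : ¬ Φ.graph.neighborSet u ⊆ Φ.graph.neighborFinset v := fun hs => by
    refine hne (Finset.eq_of_subset_of_card_le (fun t ht => ?_) ?_)
    · exact_mod_cast hs (by simpa using ht)
    · simp [hu, hv]
  obtain ⟨w, hw⟩ := hpos v
  have h1 := Φ.one_le_rowRank hw (W := Φ.graph.neighborFinset v) (by simp)
  set W := Φ.graph.neighborFinset v ∪ Φ.graph.neighborFinset u with hW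
  have h2 := Φ.rowRank_lt (W := Φ.graph.neighborFinset v) (W' := W) (v := u)
    (by exact_mod_cast Finset.subset_union_left) hnot (by simp [hW])
  have h3 := hrow W ⟨w, by simp [hW, hw]⟩
  have h4 := Finset.card_union_add_card_inter (Φ.graph.neighborFinset v) (Φ.graph.neighborFinset u)
  simp only [SimpleGraph.card_neighborFinset_eq_degree, hu, hv, ← hW] at h4
  have h5 := Nat.mul_le_mul_right d (show 2 ≤ Φ.rowRank W by omega)
  omega

/-- In the extremal case with maximum degree at least three there are two vertices with the same
neighbourhood. -/
theorem exists_neighborFinset_eq [Nonempty V] (hd2 : 2 ≤ d) :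
    ∃ u v, u ≠ v ∧ Φ.graph.neighborFinset u = Φ.graph.neighborFinset v := by
  have hreg := degree_eq_of_rowRank_le hd hpos hrow
  have hother : ∀ w v, Φ.graph.Adj w v → ∃ u, Φ.graph.Adj w u ∧ u ≠ v := fun w v hv => by
    obtain ⟨u, hu, hne⟩ := Finset.exists_mem_ne
      (s := Φ.graph.neighborFinset w) (by simp [hreg]; omega) v
    exact ⟨u, by simpa using hu, hne⟩
  by_contra hno
  push Not at hno
  classical
  -- Sets attaining the bound that can still grow by an overlapping neighbourhood; a largest one is
  -- one step away from closure.
  let S : Finset (Finset V) := Finset.univ.filter fun W : Finset V =>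
    W.Nonempty ∧ W.card ≤ 1 + Φ.rowRank W * d ∧ ¬ Φ.graph.NbhdClosed (W : Set V)
  have hS : S.Nonempty := by
    obtain ⟨v⟩ := ‹Nonempty V›
    obtain ⟨w, hw⟩ := hpos v
    refine ⟨Φ.graph.neighborFinset v, ?_⟩
    simp only [S, Finset.mem_filter, Finset.mem_univ, true_and]
    refine ⟨⟨w, by simpa using hw⟩, ?_, fun hc => ?_⟩
    · have := Nat.mul_le_mul_right d
        (Φ.one_le_rowRank hw (W := Φ.graph.neighborFinset v) (by simp))
      rw [SimpleGraph.card_neighborFinset_eq_degree, hreg]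
      omega
    -- If N(v) were closed, another neighbour u of w would have N(u) ⊆ N(v), making u and v twins.
    · obtain ⟨u, hu, hne⟩ := hother w v hw.symm
      have hs := hc hu.symm (by simpa using hw)
      refine hno u v hne (Finset.eq_of_subset_of_card_le (fun t ht => ?_) ?_)
      · exact_mod_cast hs (by simpa using ht)
      · simp [hreg]
  obtain ⟨W, hWS, hmax⟩ := S.exists_max_image Finset.card hS
  simp only [S, Finset.mem_filter, Finset.mem_univ, true_and] at hWS hmax
  obtain ⟨hne, htight, hncl⟩ := hWS
  simp only [SimpleGraph.NbhdClosed, not_forall] at hncl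
  obtain ⟨v, x, hvx, hx, hv⟩ := hncl
  set W₁ := W ∪ Φ.graph.neighborFinset v with hW₁
  have hlt : Φ.rowRank W < Φ.rowRank W₁ :=
    Φ.rowRank_lt (by exact_mod_cast Finset.subset_union_left) hv
      (by intro t ht; simp [hW₁]; exact Or.inr ht)
  have hinter : 0 < (W ∩ Φ.graph.neighborFinset v).card :=
    Finset.card_pos.2 ⟨x, by simp_all⟩
  have hcard := Finset.card_union_add_card_inter W (Φ.graph.neighborFinset v)
  rw [← hW₁, SimpleGraph.card_neighborFinset_eq_degree, hreg] at hcard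
  have hmul := Nat.mul_le_mul_right d (Nat.succ_le_of_lt hlt)
  rw [Nat.succ_mul] at hmul
  have hW₁card : W.card < W₁.card := by
    refine Finset.card_lt_card (Finset.ssubset_iff_subset_ne.2 ⟨Finset.subset_union_left, ?_⟩)
    intro h
    rw [← h] at hlt
    exact hlt.false
  -- The enlarged set again attains the bound, so maximality leaves only closedness.
  have hcl : Φ.graph.NbhdClosed (W₁ : Set V) := by
    by_contra hcl
    have := hmax W₁ ⟨hne.mono Finset.subset_union_left, by omega, hcl⟩
    omega
  obtain ⟨w, hvw, hwW⟩ := Set.not_subset.1 hv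
  obtain ⟨u, hwu, huv⟩ := hother w v hvw.symm
  have hNu : Φ.graph.neighborFinset u ⊆ W₁ := fun t ht => by
    exact_mod_cast hcl hwu.symm (by simp [hW₁]; exact Or.inr hvw) (by simpa using ht)
  have hnot : ¬ Φ.graph.neighborSet u ⊆ W := fun h => hwW (h hwu.symm)
  set W₂ := W ∪ Φ.graph.neighborFinset u with hW₂
  have hlt₂ : Φ.rowRank W < Φ.rowRank W₂ :=
    Φ.rowRank_lt (by exact_mod_cast Finset.subset_union_left) hnot
      (by intro t ht; simp [hW₂]; exact Or.inr ht)
  have hcard₂ := Finset.card_union_add_card_inter W (Φ.graph.neighborFinset u)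
  rw [← hW₂, SimpleGraph.card_neighborFinset_eq_degree, hreg] at hcard₂
  have hmul₂ := Nat.mul_le_mul_right d (Nat.succ_le_of_lt hlt₂)
  rw [Nat.succ_mul] at hmul₂
  have hrow₂ := hrow W₂ (hne.mono Finset.subset_union_left)
  -- Adding N(u) to the tight set W raises `rowRank`, so at least d vertices of N(u) lie outside W;
  -- these must belong to N(v), and d ≥ 2.
  have hle : (W ∩ Φ.graph.neighborFinset u).card ≤ 1 := by omega
  refine hno u v huv (neighborFinset_eq_of_two_le_card_inter hd hpos hrow ?_)
  have hcover : Φ.graph.neighborFinset u ⊆ (W ∩ Φ.graph.neighborFinset u) ∪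
      (Φ.graph.neighborFinset v ∩ Φ.graph.neighborFinset u) := fun t ht => by
    have := hNu ht
    rw [hW₁, Finset.mem_union] at this
    rw [Finset.mem_union, Finset.mem_inter, Finset.mem_inter]
    tauto
  have := (Finset.card_le_card hcover).trans (Finset.card_union_le _ _)
  rw [SimpleGraph.card_neighborFinset_eq_degree, hreg] at this
  omega

/-- In the extremal case, two vertices with the same neighbourhood force the graph to be complete
bipartite. -/
theorem exists_parts_of_neighborFinset_eq (hd1 : 1 ≤ d) (hconn : Φ.graph.Connected) {u v : V}
    (huv : u ≠ v) (h : Φ.graph.neighborFinset u = Φ.graph.neighborFinset v) :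
    ∃ X Y : Finset V, X.card = d + 1 ∧ Y.card = d + 1 ∧ Disjoint X Y ∧ (∀ z, z ∈ X ∨ z ∈ Y) ∧
      (∀ x ∈ X, Φ.graph.neighborFinset x = Y) ∧ (∀ y ∈ Y, Φ.graph.neighborFinset y = X) := by
  have hreg := degree_eq_of_rowRank_le hd hpos hrow
  have hadj : ∀ t, Φ.graph.Adj u t ↔ Φ.graph.Adj v t := fun t => by
    rw [← SimpleGraph.mem_neighborFinset, h, SimpleGraph.mem_neighborFinset]
  -- For another neighbour y of u, both x and y see the twins u and v, so N(x) = N(y). Thus w is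
  -- adjacent to y too, and shares x and y with u.
  have key : ∀ w x, Φ.graph.Adj u x → Φ.graph.Adj w x →
      Φ.graph.neighborFinset w = Φ.graph.neighborFinset u := fun w x hux hwx => by
    refine neighborFinset_eq_of_two_le_card_inter hd hpos hrow ?_
    obtain ⟨y, hy, hyx⟩ := Finset.exists_mem_ne
      (s := Φ.graph.neighborFinset u) (by simp [hreg]; omega) x
    rw [SimpleGraph.mem_neighborFinset] at hy
    have hxy : Φ.graph.neighborFinset x = Φ.graph.neighborFinset y := by
      refine neighborFinset_eq_of_two_le_card_inter hd hpos hrow ?_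
      rw [← Finset.card_pair huv]
      refine Finset.card_le_card fun t ht => ?_
      simp only [Finset.mem_insert, Finset.mem_singleton] at ht
      simp only [Finset.mem_inter, SimpleGraph.mem_neighborFinset]
      rcases ht with rfl | rfl
      · exact ⟨hy.symm, hux.symm⟩
      · exact ⟨((hadj _).1 hy).symm, ((hadj _).1 hux).symm⟩
    have hyw : Φ.graph.Adj y w := by
      rw [← SimpleGraph.mem_neighborFinset, ← hxy, SimpleGraph.mem_neighborFinset]
      exact hwx.symm
    rw [← Finset.card_pair hyx]
    refine Finset.card_le_card fun t ht => ?_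
    simp only [Finset.mem_insert, Finset.mem_singleton] at ht
    simp only [Finset.mem_inter, SimpleGraph.mem_neighborFinset]
    rcases ht with rfl | rfl
    · exact ⟨hy, hyw.symm⟩
    · exact ⟨hux, hwx⟩
  obtain ⟨x₀, hx₀⟩ := hpos u
  have hY : ∀ y ∈ Φ.graph.neighborFinset x₀,
      Φ.graph.neighborFinset y = Φ.graph.neighborFinset u := fun y hy =>
    key y x₀ hx₀ (by simpa [SimpleGraph.adj_comm] using hy)
  have hX : ∀ x ∈ Φ.graph.neighborFinset u,
      Φ.graph.neighborFinset x = Φ.graph.neighborFinset x₀ := fun x hx => by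
    refine Finset.eq_of_subset_of_card_le (fun w hw => ?_) (by simp [hreg])
    have hw' := key w x (by simpa using hx) (by simpa [SimpleGraph.adj_comm] using hw)
    rw [SimpleGraph.mem_neighborFinset, SimpleGraph.adj_comm, ← SimpleGraph.mem_neighborFinset, hw',
      SimpleGraph.mem_neighborFinset]
    exact hx₀
  refine ⟨Φ.graph.neighborFinset u, Φ.graph.neighborFinset x₀, by simp [hreg], by simp [hreg],
    ?_, fun z => ?_, hX, hY⟩
  · rw [Finset.disjoint_left]
    intro z hz hz'
    have h1 := hY z hz'
    have : z ∈ Φ.graph.neighborFinset z := h1 ▸ hz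
    simp at this
  · obtain ⟨p⟩ := hconn.preconnected u z
    have : ∀ {a b : V} (p : Φ.graph.Walk a b),
        (a ∈ Φ.graph.neighborFinset u ∨ a ∈ Φ.graph.neighborFinset x₀) →
        (b ∈ Φ.graph.neighborFinset u ∨ b ∈ Φ.graph.neighborFinset x₀) := by
      intro a b p
      induction p with
      | nil => exact id
      | @cons a b c hab p ih =>
        rw [← SimpleGraph.mem_neighborFinset] at hab
        rintro (ha | ha)
        · exact ih (Or.inr (hX a ha ▸ hab))
        · exact ih (Or.inl (hY a ha ▸ hab))
    exact this p (Or.inr (by simpa using hx₀.symm))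

end Extremal

end TGainGraph

/-! ### Balance, potentials and complete bipartite graphs -/

namespace TGainGraph

variable {V : Type*} {Φ : TGainGraph V}

theorem mul_walkGain {p : V → ℂ} (hp : ∀ s t, Φ.graph.Adj s t → p s * Φ.adjMatrix s t = p t)
    {u v : V} (w : Φ.graph.Walk u v) : p u * Φ.walkGain w = p v := by
  induction w with
  | nil => simp [walkGain]
  | @cons a b c h w ih =>
    rw [← ih, ← hp a b h, adjMatrix_of_adj _ h]
    simp [walkGain, mul_assoc]

/-- A gain graph whose gains are the quotients of a nowhere vanishing potential is balanced. -/
theorem balanced_of_potential {p : V → ℂ} (hp0 : ∀ v, p v ≠ 0)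
    (hp : ∀ s t, Φ.graph.Adj s t → p s * Φ.adjMatrix s t = p t) : Φ.Balanced := by
  intro v w _
  have h := mul_walkGain hp w
  rw [mul_eq_left₀ (hp0 v)] at h
  exact Circle.coe_eq_one.1 h

/-- This is gain 1 on the 4-cycle a, x, b, y; the coincidences a = b and x = y are trivial. -/
theorem Balanced.mul_eq_mul (hΦ : Φ.Balanced) {a b x y : V} (hax : Φ.graph.Adj a x)
    (hbx : Φ.graph.Adj b x) (hby : Φ.graph.Adj b y) (hay : Φ.graph.Adj a y) :
    Φ.adjMatrix a x * Φ.adjMatrix b y = Φ.adjMatrix a y * Φ.adjMatrix b x := by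
  by_cases hab : a = b
  · subst hab; ring
  by_cases hxy : x = y
  · subst hxy; ring
  let p : Φ.graph.Walk a a := .cons hax (.cons hbx.symm (.cons hby (.cons hay.symm .nil)))
  have hp : p.IsCycle := by
    have := hax.ne; have := hbx.ne; have := hay.ne; have := hby.ne
    rw [SimpleGraph.Walk.isCycle_def]
    refine ⟨?_, ?_, ?_⟩
    · rw [SimpleGraph.Walk.isTrail_def]
      simp [p]
      grind
    · simp [p]
    · simp [p]
      grind
  have h := hΦ a p hp
  have h' : Φ.adjMatrix a x * (Φ.adjMatrix x b * (Φ.adjMatrix b y * Φ.adjMatrix y a)) = 1 := by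
    rw [adjMatrix_of_adj _ hax, adjMatrix_of_adj _ hbx.symm, adjMatrix_of_adj _ hby,
      adjMatrix_of_adj _ hay.symm]
    simp only [walkGain, p, SimpleGraph.Walk.darts_cons, SimpleGraph.Walk.darts_nil, List.map_cons,
      List.map_nil, List.prod_cons, List.prod_nil, mul_one] at h
    exact_mod_cast congrArg Circle.coeHom h
  have h1 := Φ.adjMatrix_mul_swap hbx
  have h2 := Φ.adjMatrix_mul_swap hay
  linear_combination (Φ.adjMatrix b x * Φ.adjMatrix a y) * h' -
    (Φ.adjMatrix a x * Φ.adjMatrix b y * Φ.adjMatrix a y * Φ.adjMatrix y a) * h1 -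
    (Φ.adjMatrix a x * Φ.adjMatrix b y) * h2

/-- The scalar is the gain of the path a, x, b, which by the 4-cycle relation does not depend on the
middle vertex. -/
theorem Balanced.exists_row_eq_smul (hΦ : Φ.Balanced) {a b : V} {x : V} (hax : Φ.graph.Adj a x)
    (hab : ∀ z, Φ.graph.Adj a z ↔ Φ.graph.Adj b z) :
    ∃ c : ℂ, Φ.adjMatrix.row a = c • Φ.adjMatrix.row b := by
  refine ⟨Φ.adjMatrix a x * Φ.adjMatrix x b, funext fun z => ?_⟩
  simp only [Matrix.row, Pi.smul_apply, smul_eq_mul]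
  by_cases hz : Φ.graph.Adj a z
  · have h1 := hΦ.mul_eq_mul hz ((hab z).1 hz) ((hab x).1 hax) hax
    have h2 := Φ.adjMatrix_mul_swap ((hab x).1 hax)
    linear_combination Φ.adjMatrix x b * h1 - Φ.adjMatrix a z * h2
  · rw [adjMatrix_of_not_adj _ hz, adjMatrix_of_not_adj _ fun h => hz ((hab z).2 h), mul_zero]

variable [Fintype V]

theorem IsBalancedCompleteBipartite.rank_le_two {m : ℕ} (h : Φ.IsBalancedCompleteBipartite m)
    (hm : 0 < m) : Φ.rank ≤ 2 := by
  classical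
  obtain ⟨⟨e⟩, hΦ⟩ := h
  have hadj : ∀ s t, Φ.graph.Adj (e s) (e t) ↔
      (completeBipartiteGraph (Fin m) (Fin m)).Adj s t := fun s t => e.map_adj_iff
  let x : V := e (.inl ⟨0, hm⟩)
  let y : V := e (.inr ⟨0, hm⟩)
  rw [rank, Matrix.rank_eq_finrank_span_row]
  have hle : Submodule.span ℂ (Set.range Φ.adjMatrix.row) ≤
      Submodule.span ℂ (({Φ.adjMatrix.row x, Φ.adjMatrix.row y} : Finset (V → ℂ)) : Set _) := by
    rw [Submodule.span_le]
    rintro _ ⟨v, rfl⟩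
    obtain ⟨i, rfl⟩ := e.surjective v
    rcases i with i | i
    · obtain ⟨c, hc⟩ := hΦ.exists_row_eq_smul (a := e (.inl i)) (b := x) (x := y)
        ((hadj _ _).2 (by simp)) (fun z => by
          obtain ⟨j, rfl⟩ := e.surjective z
          simp [hadj, x])
      rw [hc]
      exact Submodule.smul_mem _ _ (Submodule.subset_span (by simp))
    · obtain ⟨c, hc⟩ := hΦ.exists_row_eq_smul (a := e (.inr i)) (b := y) (x := x)
        ((hadj _ _).2 (by simp)) (fun z => by
          obtain ⟨j, rfl⟩ := e.surjective z
          simp [hadj, y])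
      rw [hc]
      exact Submodule.smul_mem _ _ (Submodule.subset_span (by simp))
  exact (Submodule.finrank_mono hle).trans ((finrank_span_finset_le_card _).trans
    Finset.card_le_two)

theorem IsBalancedCompleteBipartite.maxDegree_eq [DecidableRel Φ.graph.Adj] {m : ℕ}
    (h : Φ.IsBalancedCompleteBipartite m) : Φ.graph.maxDegree = m := by
  classical
  obtain ⟨⟨e⟩, -⟩ := h
  rw [← e.maxDegree_eq]
  rcases Nat.eq_zero_or_pos m with rfl | hm
  · exact SimpleGraph.maxDegree_of_subsingleton _
  have : Nonempty (Fin m ⊕ Fin m) := ⟨.inl ⟨0, hm⟩⟩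
  refine SimpleGraph.IsRegularOfDegree.maxDegree_eq _ fun v => ?_
  rcases v with v | v
  · have : (completeBipartiteGraph (Fin m) (Fin m)).neighborFinset (.inl v) =
        Finset.univ.map Function.Embedding.inr := by
      ext (z | z) <;> simp
    rw [← SimpleGraph.card_neighborFinset_eq_degree, this, Finset.card_map, Finset.card_fin]
  · have : (completeBipartiteGraph (Fin m) (Fin m)).neighborFinset (.inr v) =
        Finset.univ.map Function.Embedding.inl := by
      ext (z | z) <;> simp
    rw [← SimpleGraph.card_neighborFinset_eq_degree, this, Finset.card_map, Finset.card_fin]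

/-- The rows of the vertices in Y span a space of dimension at most one, so they are proportional;
this makes gains path-independent and yields a potential. -/
theorem isBalancedCompleteBipartite_of_parts {m : ℕ} {X Y : Finset V} (hm : 0 < m)
    (hX : X.card = m) (hY : Y.card = m) (hXY : Disjoint X Y) (hcov : ∀ z, z ∈ X ∨ z ∈ Y)
    (hNX : ∀ x ∈ X, ∀ z, Φ.graph.Adj x z ↔ z ∈ Y) (hNY : ∀ y ∈ Y, ∀ z, Φ.graph.Adj y z ↔ z ∈ X)
    (hrank : Φ.rowRank X ≤ 1) : Φ.IsBalancedCompleteBipartite m := by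
  classical
  have hXY' : ∀ z ∈ X, z ∉ Y := fun z h h' => Finset.disjoint_left.1 hXY h h'
  refine ⟨?_, ?_⟩
  · let eX := X.equivFinOfCardEq hX
    let eY := Y.equivFinOfCardEq hY
    let f : Fin m ⊕ Fin m → V := Sum.elim (fun i => eX.symm i) (fun i => eY.symm i)
    have hf : Function.Bijective f := by
      constructor
      · rintro (i | i) (j | j) hij
        · simpa [f, Subtype.ext_iff] using hij
        · exact absurd (eX.symm i).2 fun h => hXY' _ h (by
            have : ((eX.symm i : X) : V) = (eY.symm j : Y) := hij
            rw [this]; exact (eY.symm j).2)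
        · exact absurd (eX.symm j).2 fun h => hXY' _ h (by
            have : ((eY.symm i : Y) : V) = (eX.symm j : X) := hij
            rw [← this]; exact (eY.symm i).2)
        · simpa [f, Subtype.ext_iff] using hij
      · intro z
        rcases hcov z with h | h
        · exact ⟨.inl (eX ⟨z, h⟩), by simp [f]⟩
        · exact ⟨.inr (eY ⟨z, h⟩), by simp [f]⟩
    refine ⟨⟨Equiv.ofBijective f hf, ?_⟩⟩
    rintro (i | i) (j | j)
    · have := hXY' _ (eX.symm j).2
      simp [f, hNX _ (eX.symm i).2, this]
    · simp [f, hNX _ (eX.symm i).2]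
    · simp [f, hNY _ (eY.symm i).2]
    · have : ((eY.symm j : Y) : V) ∉ X := fun h => hXY' _ h (eY.symm j).2
      simp [f, hNY _ (eY.symm i).2, this]
  · obtain ⟨x₀, hx₀⟩ := Finset.card_pos.1 (hX ▸ hm)
    obtain ⟨y₀, hy₀⟩ := Finset.card_pos.1 (hY ▸ hm)
    obtain ⟨r, hr⟩ := finrank_le_one_iff.1 hrank
    have hmul : ∀ y ∈ Y, ∀ x, Φ.adjMatrix y₀ x₀ * Φ.adjMatrix y x =
        Φ.adjMatrix y x₀ * Φ.adjMatrix y₀ x := fun y hy x => by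
      have hmem : ∀ y ∈ Y, ∃ c : ℂ, ∀ x, Φ.adjMatrix y x = c * r.1 x := fun y hy => by
        obtain ⟨c, hc⟩ := hr ⟨_, Φ.row_mem_rowSpan (v := y) (W := X)
          (fun z hz => by exact_mod_cast (hNY y hy z).1 hz)⟩
        refine ⟨c, fun x => ?_⟩
        exact (congrFun (congrArg Subtype.val hc) x).symm
      obtain ⟨c, hc⟩ := hmem y hy
      obtain ⟨c₀, hc₀⟩ := hmem y₀ hy₀
      simp only [hc, hc₀]
      ring
    -- The potential is the gain of a walk from y₀: directly to a vertex of X, or through x₀ to a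
    -- vertex of Y.
    let p : V → ℂ := fun z => if z ∈ X then Φ.adjMatrix y₀ z else
      Φ.adjMatrix x₀ z * Φ.adjMatrix y₀ x₀
    have hpX : ∀ x ∈ X, p x = Φ.adjMatrix y₀ x := fun x hx => by simp [p, hx]
    have hpY : ∀ y ∈ Y, p y = Φ.adjMatrix x₀ y * Φ.adjMatrix y₀ x₀ := fun y hy => by
      simp [p, show y ∉ X from fun h => hXY' y h hy]
    have hyx : ∀ y ∈ Y, ∀ x ∈ X, p y * Φ.adjMatrix y x = p x := fun y hy x hx => by
      rw [hpX x hx, hpY y hy]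
      have := Φ.adjMatrix_mul_swap ((hNX x₀ hx₀ y).2 hy)
      linear_combination Φ.adjMatrix x₀ y * hmul y hy x + Φ.adjMatrix y₀ x * this
    refine balanced_of_potential (p := p) (fun v => ?_) fun s t hst => ?_
    · rcases hcov v with h | h
      · rw [hpX v h]
        exact Φ.adjMatrix_ne_zero_iff.2 ((hNY y₀ hy₀ v).2 h)
      · rw [hpY v h]
        exact mul_ne_zero (Φ.adjMatrix_ne_zero_iff.2 ((hNX x₀ hx₀ v).2 h))
          (Φ.adjMatrix_ne_zero_iff.2 ((hNY y₀ hy₀ x₀).2 hx₀))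
    · rcases hcov s with h | h
      · rw [← hyx t ((hNX s h t).1 hst) s h, mul_assoc, Φ.adjMatrix_mul_swap hst.symm, mul_one]
      · exact hyx s h t ((hNY s h t).1 hst)

end TGainGraph

/-! ### Connected 2-regular graphs -/

namespace SimpleGraph

variable {V : Type*} {G : SimpleGraph V} [Fintype V] [DecidableRel G.Adj]

theorem degree_cycleGraph {n : ℕ} (hn : 3 ≤ n) (v : Fin n) : (cycleGraph n).degree v = 2 := by
  obtain ⟨k, rfl⟩ := Nat.exists_eq_add_of_le' hn
  exact cycleGraph_degree_three_le

/-- A connected graph that is regular of degree two is a cycle. -/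
theorem IsRegularOfDegree.nonempty_cycleGraph_iso (hG : G.Connected)
    (h : G.IsRegularOfDegree 2) :
    3 ≤ Fintype.card V ∧ Nonempty (cycleGraph (Fintype.card V) ≃g G) := by
  classical
  obtain ⟨v⟩ := hG.nonempty
  have hcyc : G.IsCycles := fun w _ => by
    rw [Set.ncard_eq_toFinset_card', Set.toFinset_card, card_neighborSet_eq_degree, h w]
  obtain ⟨p, hp, hverts⟩ := hcyc.exists_cycle_toSubgraph_verts_eq_connectedComponentSupp
    (c := G.connectedComponentMk v) (v := v) (by simp)
    ((G.degree_pos_iff_nonempty (v := v)).1 (by rw [h v]; norm_num))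
  have hsupp : ∀ w, w ∈ p.support.tail := fun w => by
    have : w ∈ p.toSubgraph.verts := by
      rw [hverts, ConnectedComponent.mem_supp_iff, ConnectedComponent.eq]
      exact hG.preconnected w v
    rw [Walk.mem_verts_toSubgraph, Walk.mem_support_iff] at this
    rcases this with rfl | h
    · exact Walk.end_mem_tail_support hp.not_nil
    · exact h
  have hlen : p.length = Fintype.card V := by
    have h1 : p.support.tail.toFinset = Finset.univ :=
      Finset.eq_univ_iff_forall.2 fun w => List.mem_toFinset.2 (hsupp w)
    have h2 := List.toFinset_card_of_nodup hp.support_nodup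
    rw [h1, Finset.card_univ, List.length_tail, Walk.length_support] at h2
    omega
  have h3 : 3 ≤ Fintype.card V := hlen ▸ hp.three_le_length
  refine ⟨h3, ?_⟩
  obtain ⟨f⟩ := (cycleGraph_isContained_iff (G := G) h3).2 ⟨v, p, hp, hlen⟩
  have hbij : Function.Bijective f.toHom :=
    (Fintype.bijective_iff_injective_and_card _).2 ⟨f.injective, by simp⟩
  refine ⟨⟨Equiv.ofBijective f.toHom hbij, fun {a b} => ⟨fun hab => ?_, f.toHom.map_adj⟩⟩⟩
  -- The bijective homomorphism reflects adjacency: it maps neighbourhoods injectively into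
  -- neighbourhoods of the same size 2.
  have himg : ((cycleGraph (Fintype.card V)).neighborFinset a).image f.toHom =
      G.neighborFinset (f.toHom a) := by
    refine Finset.eq_of_subset_of_card_le (fun t ht => ?_) ?_
    · obtain ⟨s, hs, rfl⟩ := Finset.mem_image.1 ht
      rw [mem_neighborFinset] at hs ⊢
      exact f.toHom.map_adj hs
    · rw [Finset.card_image_of_injective _ f.injective, card_neighborFinset_eq_degree,
        card_neighborFinset_eq_degree, degree_cycleGraph h3, h]
  have hb : f.toHom b ∈ G.neighborFinset (f.toHom a) := (mem_neighborFinset _ _ _).2 hab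
  rw [← himg] at hb
  obtain ⟨s, hs, hsb⟩ := Finset.mem_image.1 hb
  rw [← f.injective hsb]
  exact (mem_neighborFinset _ _ _).1 hs

end SimpleGraph

/-! ### The kernel of a gain graph on a cycle -/

namespace TGainGraph

open Finset

variable {V : Type*} {Φ : TGainGraph V}

/-- The vertices of a cycle, listed periodically. -/
def cycleVert {k : ℕ} (e : SimpleGraph.cycleGraph (k + 3) ≃g Φ.graph) (i : ℕ) : V :=
  e (Fin.ofNat (k + 3) i)

section Cycle

variable {k : ℕ} (e : SimpleGraph.cycleGraph (k + 3) ≃g Φ.graph)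

/-- The gain of the walk along the first `i` edges of a cycle. -/
noncomputable def cyclePartialGain (i : ℕ) : ℂ :=
  ∏ j ∈ range i, Φ.adjMatrix (cycleVert e j) (cycleVert e (j + 1))

theorem cycleVert_add_card (i : ℕ) : cycleVert e (i + (k + 3)) = cycleVert e i := by
  simp [cycleVert, Fin.ext_iff]

theorem cycleVert_symm_val (z : V) : cycleVert e (e.symm z).val = z := by
  simp [cycleVert]

theorem symm_cycleVert_val (i : ℕ) : (e.symm (cycleVert e i)).val = i % (k + 3) := by
  simp [cycleVert]

theorem exists_cycleVert_succ (z : V) : ∃ i, cycleVert e (i + 1) = z := by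
  refine ⟨(e.symm z).val + (k + 2), ?_⟩
  rw [show (e.symm z).val + (k + 2) + 1 = (e.symm z).val + (k + 3) from rfl, cycleVert_add_card,
    cycleVert_symm_val]

theorem ofNat_succ (i : ℕ) : Fin.ofNat (k + 3) (i + 1) = Fin.ofNat (k + 3) i + 1 := by
  simp [Fin.ext_iff, Fin.val_add]

theorem adj_cycleVert_succ_iff (i : ℕ) (z : V) :
    Φ.graph.Adj (cycleVert e (i + 1)) z ↔ z = cycleVert e i ∨ z = cycleVert e (i + 2) := by
  obtain ⟨j, rfl⟩ := e.surjective z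
  rw [cycleVert, e.map_adj_iff, ← SimpleGraph.mem_neighborSet, SimpleGraph.cycleGraph_neighborSet]
  rw [ofNat_succ, add_sub_cancel_right, cycleVert, cycleVert, e.injective.eq_iff,
    e.injective.eq_iff, ofNat_succ, ofNat_succ]
  rfl

theorem adj_cycleVert (i : ℕ) : Φ.graph.Adj (cycleVert e i) (cycleVert e (i + 1)) :=
  ((adj_cycleVert_succ_iff e i _).2 (Or.inl rfl)).symm

theorem cycleVert_ne (i : ℕ) : cycleVert e i ≠ cycleVert e (i + 2) := by
  rw [cycleVert, cycleVert, Ne, e.injective.eq_iff, ofNat_succ, ofNat_succ, add_assoc, left_eq_add]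
  exact ne_of_beq_false rfl

theorem cycleGain_eq : Φ.cycleGain e = cyclePartialGain e (k + 3) := by
  rw [cycleGain, cyclePartialGain, Finset.prod_range]
  refine Finset.prod_congr rfl fun i _ => ?_
  rw [finRotate_apply, cycleVert, cycleVert, ofNat_succ]
  simp

theorem cyclePartialGain_succ (i : ℕ) : cyclePartialGain e (i + 1) =
    cyclePartialGain e i * Φ.adjMatrix (cycleVert e i) (cycleVert e (i + 1)) :=
  prod_range_succ _ _

theorem cyclePartialGain_ne_zero (i : ℕ) : cyclePartialGain e i ≠ 0 :=
  prod_ne_zero_iff.2 fun j _ => Φ.adjMatrix_ne_zero_iff.2 (adj_cycleVert e j)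

/-- Vertices repeat after one turn, but partial gains pick up the cycle gain; this monodromy is the
only trace of the gains in the kernel equation. -/
theorem cyclePartialGain_add_card (i : ℕ) :
    cyclePartialGain e (i + (k + 3)) = Φ.cycleGain e * cyclePartialGain e i := by
  rw [cycleGain_eq]
  induction i with
  | zero => simp [cyclePartialGain]
  | succ i ih =>
    have h1 := cyclePartialGain_succ e (i + (k + 3))
    rw [cycleVert_add_card, add_right_comm, cycleVert_add_card, ih] at h1
    rw [h1, cyclePartialGain_succ e i, mul_assoc]

variable [Fintype V]

/-- Rescaling by partial gains is a gauge change that makes every edge along the unrolled cycle have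
gain 1. -/
theorem cyclePartialGain_mul_mulVec (x : V → ℂ) (i : ℕ) :
    cyclePartialGain e (i + 1) * (Φ.adjMatrix.mulVec x) (cycleVert e (i + 1)) =
      cyclePartialGain e i * x (cycleVert e i) +
        cyclePartialGain e (i + 2) * x (cycleVert e (i + 2)) := by
  classical
  have hsum : (Φ.adjMatrix.mulVec x) (cycleVert e (i + 1)) =
      ∑ z ∈ {cycleVert e i, cycleVert e (i + 2)}, Φ.adjMatrix (cycleVert e (i + 1)) z * x z := by
    refine (sum_subset (subset_univ _) fun z _ hz => ?_).symm
    have h : ¬ Φ.graph.Adj (cycleVert e (i + 1)) z := by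
      rw [adj_cycleVert_succ_iff]
      simpa using hz
    exact mul_eq_zero_of_left (Φ.adjMatrix_of_not_adj h) _
  rw [hsum, sum_pair (cycleVert_ne e i), cyclePartialGain_succ e (i + 1),
    cyclePartialGain_succ e i]
  have := Φ.adjMatrix_mul_swap (adj_cycleVert e i)
  linear_combination cyclePartialGain e i * x (cycleVert e i) * this

theorem cycle_mulVec_eq_zero_iff (x : V → ℂ) : Φ.adjMatrix.mulVec x = 0 ↔
    ∀ i, cyclePartialGain e (i + 2) * x (cycleVert e (i + 2)) =
      -(cyclePartialGain e i * x (cycleVert e i)) := by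
  constructor
  · intro h i
    have := cyclePartialGain_mul_mulVec e x i
    rw [h, Pi.zero_apply, mul_zero] at this
    linear_combination -this
  · intro h
    funext z
    obtain ⟨i, rfl⟩ := exists_cycleVert_succ e z
    have := cyclePartialGain_mul_mulVec e x i
    rw [h i, add_neg_cancel] at this
    exact (mul_eq_zero.1 this).resolve_left (cyclePartialGain_ne_zero e _)

/-- A gain graph on a cycle whose nullity is at least two has even length and gain `±1`. -/
theorem even_and_cycleGain_eq (hrank : Φ.rank + 2 ≤ Fintype.card V) :
    Even (k + 3) ∧ Φ.cycleGain e = (-1) ^ ((k + 3) / 2) := by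
  -- One linear condition on a kernel of dimension at least 2 leaves a nonzero vector. Its vanishing
  -- at vertex 1 kills all odd terms of y.
  obtain ⟨x, hx0, hx1, hxA⟩ : ∃ x : V → ℂ, x ≠ 0 ∧ x (cycleVert e 1) = 0 ∧
      Φ.adjMatrix.mulVec x = 0 := by
    let K := LinearMap.ker Φ.adjMatrix.mulVecLin
    let g : K →ₗ[ℂ] ℂ := (LinearMap.proj (cycleVert e 1)).domRestrict K
    have hK : 2 ≤ Module.finrank ℂ K := by
      have := Φ.adjMatrix.mulVecLin.finrank_range_add_finrank_ker
      rw [Module.finrank_fintype_fun_eq_card] at this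
      have h' : Φ.rank = Module.finrank ℂ (LinearMap.range Φ.adjMatrix.mulVecLin) := rfl
      change 2 ≤ Module.finrank ℂ (LinearMap.ker Φ.adjMatrix.mulVecLin)
      omega
    have hg : LinearMap.ker g ≠ ⊥ := LinearMap.ker_ne_bot_of_finrank_lt (by
      rw [Module.finrank_self]; omega)
    obtain ⟨x, hx, hne⟩ := Submodule.exists_mem_ne_zero_of_ne_bot hg
    exact ⟨x.1, fun h => hne (Subtype.ext h), hx, x.2⟩
  let y : ℕ → ℂ := fun i => cyclePartialGain e i * x (cycleVert e i)
  have hrec : ∀ i, y (i + 2) = -y i := (cycle_mulVec_eq_zero_iff e x).1 hxA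
  have heven : ∀ m, y (2 * m) = (-1) ^ m * y 0 := fun m => by
    induction m with
    | zero => simp
    | succ m ih => rw [mul_add, mul_one, hrec, ih]; ring
  have hodd : ∀ m, y (2 * m + 1) = 0 := fun m => by
    induction m with
    | zero => simp [y, hx1]
    | succ m ih => rw [show 2 * (m + 1) + 1 = 2 * m + 1 + 2 by ring, hrec, ih, neg_zero]
  have hy0 : y 0 ≠ 0 := fun h0 => hx0 <| funext fun z => by
    have hz : y (e.symm z).val = 0 := by
      rcases Nat.even_or_odd' (e.symm z).val with ⟨m, hm | hm⟩
      · rw [hm, heven, h0, mul_zero]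
      · rw [hm, hodd]
    have := (mul_eq_zero.1 hz).resolve_left (cyclePartialGain_ne_zero e _)
    rwa [cycleVert_symm_val] at this
  have hyn : y (k + 3) = Φ.cycleGain e * y 0 := by
    have h1 := cyclePartialGain_add_card e 0
    have h2 := cycleVert_add_card e 0
    rw [zero_add] at h1 h2
    simp only [y, h1, h2]
    ring
  have hgain : Φ.cycleGain e ≠ 0 := by
    rw [cycleGain_eq]
    exact cyclePartialGain_ne_zero e _
  rcases Nat.even_or_odd' (k + 3) with ⟨m, hm | hm⟩
  · refine ⟨⟨m, by omega⟩, ?_⟩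
    rw [show (k + 3) / 2 = m by omega]
    exact (mul_right_cancel₀ hy0 ((heven m).symm.trans ((congrArg y hm).symm.trans hyn))).symm
  · exact absurd ((hodd m).symm.trans ((congrArg y hm).symm.trans hyn)).symm
      (mul_ne_zero hgain hy0)

/-- The two solutions ζ ^ i with ζ = ±`Complex.I` descend to the cycle, because ζ ^ n = (-1) ^ (n /
2) matches the cycle gain. -/
theorem rank_add_two_le_of_cycleGain (heven : Even (k + 3))
    (hgain : Φ.cycleGain e = (-1) ^ ((k + 3) / 2)) : Φ.rank + 2 ≤ Fintype.card V := by
  have hker : ∀ ζ : ℂ, ζ ^ 2 = -1 → ∃ x : V → ℂ, Φ.adjMatrix.mulVec x = 0 ∧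
      ∀ i, x (cycleVert e i) = ζ ^ i / cyclePartialGain e i := fun ζ hζ => by
    have hper : Function.Periodic (fun i => ζ ^ i / cyclePartialGain e i) (k + 3) := fun i => by
      have hn : ζ ^ (k + 3) = Φ.cycleGain e := by
        rw [hgain, ← hζ, ← pow_mul, Nat.mul_div_cancel' heven.two_dvd]
      have h0 : Φ.cycleGain e ≠ 0 := by
        rw [cycleGain_eq]
        exact cyclePartialGain_ne_zero e _
      simp only [pow_add _ i, hn, cyclePartialGain_add_card]
      rw [mul_comm, mul_div_mul_left _ _ h0]
    refine ⟨fun z => ζ ^ (e.symm z).val / cyclePartialGain e (e.symm z).val, ?_⟩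
    have hval : ∀ i, ζ ^ (e.symm (cycleVert e i)).val /
        cyclePartialGain e (e.symm (cycleVert e i)).val = ζ ^ i / cyclePartialGain e i :=
      fun i => by
        rw [symm_cycleVert_val]
        exact hper.map_mod_nat i
    refine ⟨(cycle_mulVec_eq_zero_iff e _).2 fun i => ?_, hval⟩
    simp only [hval]
    rw [mul_div_cancel₀ _ (cyclePartialGain_ne_zero e _),
      mul_div_cancel₀ _ (cyclePartialGain_ne_zero e _), pow_add, hζ]
    ring
  obtain ⟨x, hxA, hx⟩ := hker Complex.I Complex.I_sq
  obtain ⟨x', hxA', hx'⟩ := hker (-Complex.I) (by rw [neg_sq, Complex.I_sq])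
  have hind : LinearIndependent ℂ ![x, x'] := by
    rw [LinearIndependent.pair_iff]
    intro s t hst
    have h0 := congrFun hst (cycleVert e 0)
    have h1 := congrFun hst (cycleVert e 1)
    have hP := cyclePartialGain_ne_zero e 1
    simp only [Pi.add_apply, Pi.smul_apply, smul_eq_mul, hx, hx', Pi.zero_apply, pow_zero,
      pow_one] at h0 h1
    simp only [cyclePartialGain, range_zero, prod_empty, div_one, mul_one] at h0
    -- Vertex 0 gives s + t = 0 and vertex 1 gives s - t = 0.
    have h2 : (s - t) * Complex.I = 0 := by
      field_simp at h1
      linear_combination h1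
    have h3 := (mul_eq_zero.1 h2).resolve_right Complex.I_ne_zero
    exact ⟨by linear_combination (h0 + h3) / 2, by linear_combination (h0 - h3) / 2⟩
  have hspan : Submodule.span ℂ (Set.range ![x, x']) ≤ LinearMap.ker Φ.adjMatrix.mulVecLin := by
    rw [Submodule.span_le]
    rintro _ ⟨i, rfl⟩
    fin_cases i
    · exact hxA
    · exact hxA'
  have h1 := Submodule.finrank_mono hspan
  rw [finrank_span_eq_card hind, Fintype.card_fin] at h1
  have h2 := Φ.adjMatrix.mulVecLin.finrank_range_add_finrank_ker
  rw [Module.finrank_fintype_fun_eq_card] at h2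
  have h' : Φ.rank = Module.finrank ℂ (LinearMap.range Φ.adjMatrix.mulVecLin) := rfl
  omega

end Cycle

theorem IsCycleWithGain.rank_add_two_le {n : ℕ} [Fintype V] (hn : Even n)
    (h : Φ.IsCycleWithGain n ((-1) ^ (n / 2))) : Φ.rank + 2 ≤ Fintype.card V := by
  obtain ⟨h3, e, he⟩ := h
  obtain ⟨k, rfl⟩ := Nat.exists_eq_add_of_le' h3
  exact rank_add_two_le_of_cycleGain e hn he

end TGainGraph

/-! ### Assembling the equality case -/

namespace TGainGraph

variable {V : Type*} {Φ : TGainGraph V} [Fintype V] [DecidableRel Φ.graph.Adj]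

theorem isBalancedCompleteBipartite_or_isCycleWithGain {d : ℕ} (hd1 : 1 ≤ d)
    (hd : ∀ v, Φ.graph.degree v ≤ d + 1) (hconn : Φ.graph.Connected)
    (hpos : ∀ v, ∃ w, Φ.graph.Adj v w) (heq : Fintype.card V = Φ.rank * d + 2) :
    (∃ m : ℕ, Fintype.card V = 2 * m ∧ Φ.IsBalancedCompleteBipartite m) ∨
      (Even (Fintype.card V) ∧
        Φ.IsCycleWithGain (Fintype.card V) ((-1) ^ (Fintype.card V / 2))) := by
  classical
  have hrow := Φ.one_add_rowRank_mul_le hd hconn hpos heq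
  have hreg := degree_eq_of_rowRank_le hd hpos hrow
  have := hconn.nonempty
  -- The alternatives overlap at K_{2,2} = C_4; with d = 1 the cycle alternative is always
  -- available.
  rcases hd1.eq_or_lt with rfl | hd2
  · right
    obtain ⟨h3, ⟨e⟩⟩ := SimpleGraph.IsRegularOfDegree.nonempty_cycleGraph_iso hconn hreg
    have hrank : Φ.rank + 2 ≤ Fintype.card V := by omega
    -- The length is generalised so that it can be replaced by k + 3.
    have key : ∀ n (_ : 3 ≤ n) (e : SimpleGraph.cycleGraph n ≃g Φ.graph),
        Even n ∧ Φ.cycleGain e = (-1) ^ (n / 2) := fun n hn e => by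
      obtain ⟨k, rfl⟩ := Nat.exists_eq_add_of_le' hn
      exact even_and_cycleGain_eq e hrank
    exact ⟨(key _ h3 e).1, h3, e, (key _ h3 e).2⟩
  · left
    obtain ⟨u, v, huv, hN⟩ := exists_neighborFinset_eq hd hpos hrow hd2
    obtain ⟨X, Y, hX, hY, hXY, hcov, hNX, hNY⟩ :=
      exists_parts_of_neighborFinset_eq hd hpos hrow hd1 hconn huv hN
    have hcard : Fintype.card V = 2 * (d + 1) := by
      rw [← Finset.card_univ, ← Finset.eq_univ_iff_forall.2 fun z => Finset.mem_union.2 (hcov z),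
        Finset.card_union_of_disjoint hXY]
      omega
    refine ⟨d + 1, hcard, isBalancedCompleteBipartite_of_parts (Nat.succ_pos d) hX hY hXY hcov
      (fun x hx z => by rw [← hNX x hx, SimpleGraph.mem_neighborFinset])
      (fun y hy z => by rw [← hNY y hy, SimpleGraph.mem_neighborFinset]) ?_⟩
    have h := hrow X (Finset.card_pos.1 (by omega))
    refine Nat.le_of_mul_le_mul_right (c := d) ?_ hd1
    omega

theorem IsCycleWithGain.maxDegree_eq {n : ℕ} {z : ℂ} (h : Φ.IsCycleWithGain n z) :
    Φ.graph.maxDegree = 2 := by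
  obtain ⟨h3, e, -⟩ := h
  have : Nonempty (Fin n) := ⟨⟨0, by omega⟩⟩
  rw [← e.maxDegree_eq]
  exact SimpleGraph.IsRegularOfDegree.maxDegree_eq _ (SimpleGraph.degree_cycleGraph h3)

end TGainGraph

theorem theorem4p1 {V : Type*} [Fintype V] (Φ : TGainGraph V) [DecidableRel Φ.graph.Adj]
    (hconn : Φ.graph.Connected) (hΔ : 2 ≤ Φ.graph.maxDegree) :
    ((Fintype.card V : ℝ) - 2) / ((Φ.graph.maxDegree : ℝ) - 1) ≤ (Φ.rank : ℝ) ∧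
    ((Φ.rank : ℝ) = ((Fintype.card V : ℝ) - 2) / ((Φ.graph.maxDegree : ℝ) - 1) ↔
      (∃ m : ℕ, Fintype.card V = 2 * m ∧ Φ.IsBalancedCompleteBipartite m) ∨
      (Even (Fintype.card V) ∧
        Φ.IsCycleWithGain (Fintype.card V) ((-1) ^ (Fintype.card V / 2)))) := by
  classical
  obtain ⟨d, hd⟩ : ∃ d, Φ.graph.maxDegree = d + 1 := ⟨_, (Nat.sub_add_cancel (by omega)).symm⟩
  have hd1 : 1 ≤ d := by omega
  have hdeg : ∀ v, Φ.graph.degree v ≤ d + 1 := fun v => hd ▸ Φ.graph.degree_le_maxDegree v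
  have hnontriv : Nontrivial V := by
    have := hconn.nonempty
    obtain ⟨v, hv⟩ := Φ.graph.exists_maximal_degree_vertex
    obtain ⟨w, hw⟩ := (Φ.graph.degree_pos_iff_exists_adj v).1 (by omega)
    exact ⟨v, w, hw.ne⟩
  have hpos : ∀ v, ∃ w, Φ.graph.Adj v w := fun v =>
    (Φ.graph.degree_pos_iff_exists_adj v).1 (hconn.preconnected.degree_pos_of_nontrivial v)
  have hle := Φ.card_le_rank_mul_add_two hdeg hconn hpos
  have hd0 : (0 : ℝ) < d := by exact_mod_cast hd1
  have hcast : ((Φ.graph.maxDegree : ℝ) - 1) = d := by rw [hd]; push_cast; ring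
  have hiff : (Φ.rank : ℝ) = ((Fintype.card V : ℝ) - 2) / d ↔
      Fintype.card V = Φ.rank * d + 2 := by
    rw [eq_div_iff hd0.ne', eq_sub_iff_add_eq, eq_comm]
    exact_mod_cast Iff.rfl
  rw [hcast, hiff]
  refine ⟨?_, TGainGraph.isBalancedCompleteBipartite_or_isCycleWithGain hd1 hdeg hconn hpos, ?_⟩
  · rw [div_le_iff₀ hd0, sub_le_iff_le_add]
    exact_mod_cast hle
  · rintro (⟨m, hm, h⟩ | ⟨heven, h⟩)
    -- Here n = 2d + 2 and r ≤ 2, so r d + 2 ≤ n, the reverse of the general bound.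
    · have hmd : m = d + 1 := h.maxDegree_eq.symm.trans hd
      have h2 := Nat.mul_le_mul_right d (h.rank_le_two (by omega))
      omega
    · have hd2 : d = 1 := by have := h.maxDegree_eq; omega
      have h2 := h.rank_add_two_le heven
      subst hd2
      omega
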